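/- Let $\Gamma$ be a simple graph with vertex set $\{1,\dots,N\}$, and let $A=\langle a_1,\dots,a_N \mid a_ia_j=a_ja_i \text{ whenever } i,j \text{ are not joined by an edge of } \Gamma\rangle$ be the corresponding right-angled Artin group. Words are finite sequences of letters $a_i^{\pm1}$, $1\le i\le N$; the index of the letter $a_i^{\pm1}$ is $i$. Say that the letters $a_i^{\pm1}$ and $a_j^{\pm1}$ commute if $i,j$ are not joined by an edge of $\Gamma$ (in particular if $i=j$). A word is *reduced* if it has no subword $a_i^{\varepsilon}xa_i^{-\varepsilon}$ with $\varepsilon=\pm1$ and all letters of $x$ commuting with $a_i$. A reduced word $w$ is *initially normal* if it is empty, or if the index of its first letter is greater than or equal to the index of the first letter of every reduced word representing the same element of $A$ as $w$; a reduced word is *normal* if all its suffixes are initially normal. A word is *cyclically reduced* if it is reduced and every word obtained from it by a finite sequence of cyclings (moving the first letter to the end) and commutations (exchanging two adjacent commuting letters) is reduced. A cyclically reduced word is a *cyclic normal form* if it and all its cyclic permutations are normal. Let $w$ and $w'$ be two cyclic normal forms. Then $w$ and $w'$ represent conjugate elements of $A$ if and only if $w'$ is a cyclic permutation of $w$ (as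 a word). -/

import Mathlib

namespace RAAG

/-- A letter `a_i` (as `(i, true)`) or `a_i⁻¹` (as `(i, false)`). -/
abbrev Letter (N : ℕ) : Type := Fin N × Bool

/-- Words in the letters `a_i^{±1}`; they are not identified up to free reduction. -/
abbrev Word (N : ℕ) : Type := List (Letter N)

variable {N : ℕ}

/-- The defining relators: `a_i` and `a_j` commute whenever `i` and `j` are *not* joined by an
edge of the defining graph. -/
def relators (Γ : SimpleGraph (Fin N)) : Set (FreeGroup (Fin N)) :=
  {r | ∃ i j : Fin N, ¬ Γ.Adj i j ∧
    r = FreeGroup.of i * FreeGroup.of j * (FreeGroup.of i)⁻¹ * (FreeGroup.of j)⁻¹}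

/-- The right-angled Artin group with defining graph `Γ` (edges join non-commuting generators). -/
abbrev ArtinGroup (Γ : SimpleGraph (Fin N)) : Type := PresentedGroup (relators Γ)

/-- The element of the group represented by a word. -/
def eval (Γ : SimpleGraph (Fin N)) (w : Word N) : ArtinGroup Γ :=
  PresentedGroup.mk (relators Γ) (FreeGroup.mk w)

/-- A word is reduced if it has no subword `a_i^{±1} x a_i^{∓1}` with all letters of `x`
commuting with `a_i`. -/
def IsReduced (Γ : SimpleGraph (Fin N)) (w : Word N) : Prop :=
  ¬ ∃ (u x v : Word N) (i : Fin N) (ε : Bool),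
    w = u ++ (i, ε) :: x ++ (i, !ε) :: v ∧ ∀ l ∈ x, ¬ Γ.Adj i l.1

/-- A reduced word is initially normal if it is empty or the index of its first letter is at least
the index of the first letter of every reduced word representing the same element. -/
def IsInitiallyNormal (Γ : SimpleGraph (Fin N)) (w : Word N) : Prop :=
  IsReduced Γ w ∧ ∀ (l : Letter N) (t : Word N), w = l :: t →
    ∀ (l' : Letter N) (t' : Word N), IsReduced Γ (l' :: t') →
      eval Γ (l' :: t') = eval Γ w → l'.1 ≤ l.1

/-- A reduced word is normal if all its suffixes are initially normal. -/
def IsNormal (Γ : SimpleGraph (Fin N)) (w : Word N) : Prop :=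
  IsReduced Γ w ∧ ∀ s : Word N, s <:+ w → IsInitiallyNormal Γ s

/-- One cycling (the first letter is moved to the end) or one commutation (two adjacent letters
that commute are exchanged). -/
inductive Step (Γ : SimpleGraph (Fin N)) : Word N → Word N → Prop
  | cycling (l : Letter N) (t : Word N) : Step Γ (l :: t) (t ++ [l])
  | commutation (u v : Word N) (l l' : Letter N) (h : ¬ Γ.Adj l.1 l'.1) :
      Step Γ (u ++ l :: l' :: v) (u ++ l' :: l :: v)

/-- A word is cyclically reduced if it is reduced and every word obtained from it by a sequence of
cyclings and commutations is still reduced. -/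
def IsCyclicallyReduced (Γ : SimpleGraph (Fin N)) (w : Word N) : Prop :=
  IsReduced Γ w ∧ ∀ w' : Word N, Relation.ReflTransGen (Step Γ) w w' → IsReduced Γ w'

/-- A cyclically reduced word is a cyclic normal form if it and all its cyclic permutations
are normal. -/
def IsCyclicNormalForm (Γ : SimpleGraph (Fin N)) (w : Word N) : Prop :=
  IsCyclicallyReduced Γ w ∧ IsNormal Γ w ∧ ∀ w' : Word N, w ~r w' → IsNormal Γ w'

end RAAG

/-!
The group acts on reduced words up to commutation by left multiplication, so reduced words
representing the same element differ by commutations only. Consequently, letters can be peeled off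
a reduced conjugator of two cyclically reduced words, at the cost of cyclings and commutations of
the two words: conjugate cyclically reduced words are related by cyclings and commutations.

A cycling translates the bi-infinite word `…www…` and a commutation exchanges independent
neighbours in it, periodically; both preserve its heap, the set of positions partially ordered by
the relative order of dependent letters. If all cyclic permutations of `w` are normal, then so is
every segment of `…www…`. An isomorphism between the heaps of two normal bi-infinite words has no
inversions, so it is a translation, and `w'` is a cyclic permutation of `w`.
-/

namespace RAAG

/-! ### Words up to commutation -/

section TraceEquiv

variable {α : Type*} {C : α → α → Prop}

/-- Equality in the trace monoid of the commutation relation `C`: the words differ by exchanges of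
adjacent letters related by `C`. The inductive presentation follows that of `List.Perm`. -/
inductive TraceEquiv (C : α → α → Prop) : List α → List α → Prop
  | nil : TraceEquiv C [] []
  | cons (a : α) {u v : List α} (h : TraceEquiv C u v) : TraceEquiv C (a :: u) (a :: v)
  | swap {a b : α} (u : List α) (h : C a b) : TraceEquiv C (a :: b :: u) (b :: a :: u)
  | trans {u v w : List α} (h : TraceEquiv C u v) (h' : TraceEquiv C v w) : TraceEquiv C u w

/-- The letter `a` occurs in `u` and can be brought to the front by commutations. -/
def IsInitial (C : α → α → Prop) (a : α) (u : List α) : Prop :=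
  ∃ x v, u = x ++ a :: v ∧ ∀ b ∈ x, C a b

namespace TraceEquiv

variable {u v : List α}

@[refl] theorem refl (u : List α) : TraceEquiv C u u := by
  induction u with
  | nil => exact .nil
  | cons a u ih => exact ih.cons a

theorem symm [Std.Symm C] (h : TraceEquiv C u v) : TraceEquiv C v u := by
  induction h with
  | nil => exact .nil
  | cons a _ ih => exact ih.cons a
  | swap u h => exact .swap u (Std.Symm.symm _ _ h)
  | trans _ _ ih ih' => exact ih'.trans ih

theorem perm (h : TraceEquiv C u v) : u.Perm v := by
  induction h with
  | nil => exact .nil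
  | cons a _ ih => exact ih.cons a
  | swap u _ => exact .swap _ _ u
  | trans _ _ ih ih' => exact ih.trans ih'

theorem erase [BEq α] [LawfulBEq α] (h : TraceEquiv C u v) (a : α) :
    TraceEquiv C (u.erase a) (v.erase a) := by
  induction h with
  | nil => exact .nil
  | @cons b u v h ih =>
    by_cases hb : b = a
    · simpa [hb] using h
    · simpa [List.erase_cons, hb] using ih.cons b
  | @swap b c u h =>
    by_cases hb : b = a <;> by_cases hc : c = a
    · subst hb hc; exact refl _
    · simpa [List.erase_cons, hb, hc] using refl _
    · simpa [List.erase_cons, hb, hc] using refl _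
    · simpa [List.erase_cons, hb, hc] using swap _ h
  | trans _ _ ih ih' => exact ih.trans ih'

theorem cons_append {a : α} (h : ∀ b ∈ u, C a b) (v : List α) :
    TraceEquiv C (a :: (u ++ v)) (u ++ a :: v) := by
  induction u with
  | nil => exact refl _
  | cons b u ih =>
    rw [List.forall_mem_cons] at h
    exact (swap _ h.1).trans ((ih h.2).cons b)

end TraceEquiv

theorem not_isInitial_nil {a : α} : ¬ IsInitial C a [] := by
  rintro ⟨x, v, h, -⟩
  simp at h

theorem isInitial_cons {a b : α} {u : List α} :
    IsInitial C a (b :: u) ↔ a = b ∨ C a b ∧ IsInitial C a u := by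
  constructor
  · rintro ⟨_ | ⟨c, x⟩, v, h, hx⟩
    · exact .inl (List.cons.inj h).1.symm
    · obtain ⟨rfl, rfl⟩ := List.cons.inj h
      rw [List.forall_mem_cons] at hx
      exact .inr ⟨hx.1, x, v, rfl, hx.2⟩
  · rintro (rfl | ⟨h, x, v, rfl, hx⟩)
    · exact ⟨[], u, rfl, by simp⟩
    · exact ⟨b :: x, v, rfl, List.forall_mem_cons.2 ⟨h, hx⟩⟩

theorem isInitial_append {a : α} {u v : List α} :
    IsInitial C a (u ++ v) ↔ IsInitial C a u ∨ (∀ b ∈ u, C a b) ∧ IsInitial C a v := by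
  induction u with
  | nil => simp [not_isInitial_nil]
  | cons b u ih =>
    simp only [List.cons_append, isInitial_cons, ih, List.forall_mem_cons]
    tauto

theorem TraceEquiv.isInitial_iff [Std.Symm C] {u v : List α} (h : TraceEquiv C u v) (a : α) :
    IsInitial C a u ↔ IsInitial C a v := by
  induction h with
  | nil => rfl
  | cons b _ ih => simp only [isInitial_cons, ih]
  | swap u h =>
    have h' := Std.Symm.symm _ _ h
    simp only [isInitial_cons]
    grind
  | trans _ _ ih ih' => exact ih.trans ih'

theorem IsInitial.traceEquiv_cons_erase [Std.Symm C] [BEq α] [LawfulBEq α] {a : α}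
    {u : List α} (h : IsInitial C a u) : TraceEquiv C u (a :: u.erase a) := by
  induction u with
  | nil => exact (not_isInitial_nil h).elim
  | cons b u ih =>
    by_cases hab : a = b
    · rw [hab, List.erase_cons_head]
    · obtain ⟨hC, hu⟩ := (isInitial_cons.1 h).resolve_left hab
      rw [List.erase_cons_tail (by simpa using Ne.symm hab)]
      exact ((ih hu).cons b).trans (.swap _ (Std.Symm.symm _ _ hC))

theorem isInitial_cons_of_ne {a b : α} (h : C a b) (hne : a ≠ b) (u : List α) :
    IsInitial C a (b :: u) ↔ IsInitial C a u := by
  simp only [isInitial_cons, hne, h, true_and, false_or]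

theorem isInitial_erase_of_ne [Std.Symm C] [BEq α] [LawfulBEq α] {a b : α} (h : C a b)
    (hne : a ≠ b) {u : List α} (hb : IsInitial C b u) :
    IsInitial C a (u.erase b) ↔ IsInitial C a u := by
  rw [hb.traceEquiv_cons_erase.isInitial_iff a, isInitial_cons_of_ne h hne]

end TraceEquiv

/-! ### Reduced words -/

section Reduced

variable {N : ℕ} {Γ : SimpleGraph (Fin N)}

/-- The commutation relation on letters; letters with equal indices commute. -/
def Commutes (Γ : SimpleGraph (Fin N)) (l m : Letter N) : Prop := ¬ Γ.Adj l.1 m.1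

instance : Std.Symm (Commutes Γ) := ⟨fun _ _ hlm hml => hlm hml.symm⟩

/-- The formal inverse of a letter. -/
def Letter.inv (l : Letter N) : Letter N := (l.1, !l.2)

@[simp] theorem Letter.inv_inv (l : Letter N) : l.inv.inv = l := by simp [Letter.inv]

theorem Letter.eq_or_eq_inv_of_fst_eq {l m : Letter N} (h : l.1 = m.1) : l = m ∨ l = m.inv := by
  obtain ⟨i, a⟩ := l
  obtain ⟨j, b⟩ := m
  cases a <;> cases b <;> simp_all [Letter.inv]

theorem isReduced_nil : IsReduced Γ ([] : Word N) := by
  rintro ⟨u, x, v, i, ε, h, -⟩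
  simp at h

theorem isReduced_cons {l : Letter N} {u : Word N} :
    IsReduced Γ (l :: u) ↔ IsReduced Γ u ∧ ¬ IsInitial (Commutes Γ) l.inv u := by
  refine ⟨fun h => ⟨?_, ?_⟩, ?_⟩
  · rintro ⟨p, x, v, i, ε, rfl, hx⟩
    exact h ⟨l :: p, x, v, i, ε, rfl, hx⟩
  · rintro ⟨x, v, rfl, hx⟩
    exact h ⟨[], x, v, l.1, l.2, rfl, hx⟩
  · rintro ⟨hu, hl⟩ ⟨_ | ⟨c, p⟩, x, v, i, ε, e, hx⟩
    · obtain ⟨rfl, rfl⟩ := List.cons.inj e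
      exact hl ⟨x, v, rfl, hx⟩
    · obtain ⟨rfl, rfl⟩ := List.cons.inj e
      exact hu ⟨p, x, v, i, ε, rfl, hx⟩

theorem IsReduced.of_append_left {u v : Word N} (h : IsReduced Γ (u ++ v)) : IsReduced Γ u := by
  rintro ⟨p, x, q, i, ε, rfl, hx⟩
  exact h ⟨p, x, q ++ v, i, ε, by simp, hx⟩

theorem TraceEquiv.isReduced_iff {u v : Word N} (h : TraceEquiv (Commutes Γ) u v) :
    IsReduced Γ u ↔ IsReduced Γ v := by
  induction h with
  | nil => rfl
  | cons l h ih => rw [isReduced_cons, isReduced_cons, ih, h.isInitial_iff]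
  | @swap l m u h =>
    have inv_eq_iff : l.inv = m ↔ m.inv = l := by
      constructor <;> (rintro rfl; simp)
    have hlm : Commutes Γ l.inv m := h
    have hml : Commutes Γ m.inv l := Std.Symm.symm _ _ h
    simp only [isReduced_cons, isInitial_cons]
    tauto
  | trans _ _ ih ih' => exact ih.trans ih'

theorem exists_cancel_of_not_isReduced_append {u v : Word N} (hu : IsReduced Γ u)
    (hv : IsReduced Γ v) (h : ¬ IsReduced Γ (u ++ v)) :
    ∃ l u' v', TraceEquiv (Commutes Γ) u (u' ++ [l]) ∧
      TraceEquiv (Commutes Γ) v (l.inv :: v') := by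
  induction u with
  | nil => exact absurd hv h
  | cons b u ih =>
    rw [isReduced_cons] at hu
    by_cases huv : IsReduced Γ (u ++ v)
    · have hb : IsInitial (Commutes Γ) b.inv (u ++ v) :=
        by_contra fun hb => h (isReduced_cons.2 ⟨huv, hb⟩)
      obtain ⟨hbu, hbv⟩ := (isInitial_append.1 hb).resolve_left hu.2
      exact ⟨b, u, _, by simpa using TraceEquiv.cons_append (a := b) hbu [],
        hbv.traceEquiv_cons_erase⟩
    · obtain ⟨l, u', v', hu', hv'⟩ := ih hu.1 huv
      exact ⟨l, b :: u', v', hu'.cons b, hv'⟩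

end Reduced

/-! ### The group element represented by a word -/

section Eval

variable {N : ℕ} {Γ : SimpleGraph (Fin N)}

theorem eval_nil : eval Γ [] = 1 := rfl

theorem eval_append (u v : Word N) : eval Γ (u ++ v) = eval Γ u * eval Γ v := by
  simp only [eval, ← FreeGroup.mul_mk, map_mul]

theorem eval_cons (l : Letter N) (u : Word N) : eval Γ (l :: u) = eval Γ [l] * eval Γ u :=
  eval_append [l] u

theorem eval_singleton_inv (l : Letter N) : eval Γ [l.inv] = (eval Γ [l])⁻¹ := by
  rw [eval, eval, ← map_inv, FreeGroup.inv_mk]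
  rfl

theorem eval_surjective : Function.Surjective (eval Γ) := fun x => by
  obtain ⟨y, rfl⟩ := PresentedGroup.mk_surjective (relators Γ) x
  exact ⟨y.toWord, by rw [eval, FreeGroup.mk_toWord]⟩

theorem commute_of {i j : Fin N} (h : ¬ Γ.Adj i j) :
    Commute (PresentedGroup.of i : ArtinGroup Γ) (PresentedGroup.of j) := by
  have hr : PresentedGroup.mk (relators Γ)
      (FreeGroup.of i * FreeGroup.of j * (FreeGroup.of i)⁻¹ * (FreeGroup.of j)⁻¹) = 1 :=
    PresentedGroup.one_of_mem ⟨i, j, h, rfl⟩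
  simp only [map_mul, map_inv] at hr
  rwa [mul_inv_eq_one, mul_inv_eq_iff_eq_mul] at hr

theorem Commutes.commute_eval {l m : Letter N} (h : Commutes Γ l m) :
    Commute (eval Γ [l]) (eval Γ [m]) := by
  have eval_true (i : Fin N) : eval Γ [(i, true)] = PresentedGroup.of i := rfl
  have eval_false (i : Fin N) : eval Γ [(i, false)] = (PresentedGroup.of i)⁻¹ :=
    eval_singleton_inv (i, true)
  have hlm := commute_of h
  obtain ⟨i, a⟩ := l
  obtain ⟨j, b⟩ := m
  cases a <;> cases b <;> simpa [eval_true, eval_false] using hlm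

theorem TraceEquiv.eval_eq {u v : Word N} (h : TraceEquiv (Commutes Γ) u v) :
    eval Γ u = eval Γ v := by
  induction h with
  | nil => rfl
  | cons l _ ih => rw [eval_cons, ih, ← eval_cons]
  | @swap l m u h =>
    rw [eval_cons l, eval_cons m u, eval_cons m (l :: u), eval_cons l u, ← mul_assoc,
      ← mul_assoc, h.commute_eval.eq]
  | trans _ _ ih ih' => exact ih.trans ih'

end Eval

/-! ### The action of the group on reduced words up to commutation -/

section Action

variable {N : ℕ} {Γ : SimpleGraph (Fin N)}

open scoped Classical in
/-- The reduced form of `l :: u`, for a reduced word `u`: if `l⁻¹` can be brought to the front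
of `u`, it is cancelled against `l`. -/
noncomputable def letterMul (Γ : SimpleGraph (Fin N)) (l : Letter N) (u : Word N) : Word N :=
  if IsInitial (Commutes Γ) l.inv u then u.erase l.inv else l :: u

theorem IsReduced.letterMul {u : Word N} (h : IsReduced Γ u) (l : Letter N) :
    IsReduced Γ (letterMul Γ l u) := by
  unfold RAAG.letterMul
  split_ifs with hl
  · exact (isReduced_cons.1 (hl.traceEquiv_cons_erase.isReduced_iff.1 h)).1
  · exact isReduced_cons.2 ⟨h, hl⟩

theorem eval_letterMul (l : Letter N) (u : Word N) :
    eval Γ (letterMul Γ l u) = eval Γ (l :: u) := by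
  unfold letterMul
  split_ifs with hl
  · rw [eval_cons l, hl.traceEquiv_cons_erase.eval_eq, eval_cons l.inv, eval_singleton_inv,
      mul_inv_cancel_left]
  · rfl

theorem TraceEquiv.letterMul {u v : Word N} (h : TraceEquiv (Commutes Γ) u v) (l : Letter N) :
    TraceEquiv (Commutes Γ) (letterMul Γ l u) (letterMul Γ l v) := by
  unfold RAAG.letterMul
  rw [h.isInitial_iff]
  split_ifs
  · exact h.erase _
  · exact h.cons l

theorem letterMul_inv_letterMul {u : Word N} (h : IsReduced Γ u) (l : Letter N) :
    TraceEquiv (Commutes Γ) (letterMul Γ l.inv (letterMul Γ l u)) u := by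
  by_cases hl : IsInitial (Commutes Γ) l.inv u
  · have hcancel := isReduced_cons.1 (hl.traceEquiv_cons_erase.isReduced_iff.1 h)
    rw [Letter.inv_inv] at hcancel
    simpa [letterMul, hl, hcancel.2] using hl.traceEquiv_cons_erase.symm
  · simpa [letterMul, hl, isInitial_cons] using TraceEquiv.refl u

theorem letterMul_comm {l m : Letter N} (h : Commutes Γ l m) (hne : l.1 ≠ m.1) (u : Word N) :
    TraceEquiv (Commutes Γ) (letterMul Γ l (letterMul Γ m u))
      (letterMul Γ m (letterMul Γ l u)) := by
  have h' : Commutes Γ m l := Std.Symm.symm _ _ h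
  have ne_inv₁ : l.inv ≠ m := fun e => hne (congrArg Prod.fst e :)
  have ne_inv₂ : m.inv ≠ l := fun e => hne (congrArg Prod.fst e :).symm
  have inv_ne_inv : l.inv ≠ m.inv := fun e => hne (congrArg Prod.fst e :)
  have cons₁ := isInitial_cons_of_ne (C := Commutes Γ) (a := l.inv) h ne_inv₁
  have cons₂ := isInitial_cons_of_ne (C := Commutes Γ) (a := m.inv) h' ne_inv₂
  have erase₁ (hm : IsInitial (Commutes Γ) m.inv u) :=
    isInitial_erase_of_ne (C := Commutes Γ) (a := l.inv) (b := m.inv) h inv_ne_inv hm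
  have erase₂ (hl : IsInitial (Commutes Γ) l.inv u) :=
    isInitial_erase_of_ne (C := Commutes Γ) (a := m.inv) (b := l.inv) h' inv_ne_inv.symm hl
  by_cases hl : IsInitial (Commutes Γ) l.inv u <;> by_cases hm : IsInitial (Commutes Γ) m.inv u
  · simpa [letterMul, hl, hm, erase₁, erase₂, List.erase_comm] using TraceEquiv.refl _
  · simpa [letterMul, hl, hm, cons₁, erase₂, List.erase_cons, ne_inv₁.symm]
      using TraceEquiv.refl _
  · simpa [letterMul, hl, hm, cons₂, erase₁, List.erase_cons, ne_inv₂.symm]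
      using TraceEquiv.refl _
  · simpa [letterMul, hl, hm, cons₁, cons₂] using TraceEquiv.swap u h

/-- Trace equivalence of reduced words. -/
def reducedSetoid (Γ : SimpleGraph (Fin N)) : Setoid {u : Word N // IsReduced Γ u} where
  r u v := TraceEquiv (Commutes Γ) u.1 v.1
  iseqv := ⟨fun u => .refl u.1, fun huv => huv.symm, fun huv hvw => huv.trans hvw⟩

/-- Reduced words up to commutation; the group acts on them by left multiplication. -/
abbrev ReducedClass (Γ : SimpleGraph (Fin N)) : Type := Quotient (reducedSetoid Γ)

/-- The class of a reduced word. -/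
def ReducedClass.mk {u : Word N} (h : IsReduced Γ u) : ReducedClass Γ := ⟦⟨u, h⟩⟧

theorem ReducedClass.mk_eq_mk {u v : Word N} {hu : IsReduced Γ u} {hv : IsReduced Γ v} :
    mk hu = mk hv ↔ TraceEquiv (Commutes Γ) u v :=
  Quotient.eq

/-- The action of a letter on classes of reduced words. -/
noncomputable def letterAct (Γ : SimpleGraph (Fin N)) (l : Letter N) :
    ReducedClass Γ → ReducedClass Γ :=
  Quotient.map (fun u => ⟨letterMul Γ l u.1, u.2.letterMul l⟩) fun _ _ h => h.letterMul l

theorem letterAct_inv_letterAct (l : Letter N) (x : ReducedClass Γ) :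
    letterAct Γ l.inv (letterAct Γ l x) = x := by
  induction x using Quotient.inductionOn with
  | h u => exact Quotient.sound (letterMul_inv_letterMul u.2 l)

theorem letterAct_comm {l m : Letter N} (h : Commutes Γ l m) (hne : l.1 ≠ m.1)
    (x : ReducedClass Γ) :
    letterAct Γ l (letterAct Γ m x) = letterAct Γ m (letterAct Γ l x) := by
  induction x using Quotient.inductionOn with
  | h u => exact Quotient.sound (letterMul_comm h hne u.1)

/-- The permutation of the classes of reduced words given by a generator. -/
noncomputable def generatorPerm (Γ : SimpleGraph (Fin N)) (i : Fin N) :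
    Equiv.Perm (ReducedClass Γ) where
  toFun := letterAct Γ (i, true)
  invFun := letterAct Γ (i, false)
  left_inv := letterAct_inv_letterAct (i, true)
  right_inv := letterAct_inv_letterAct (i, false)

/-- The action of the group on classes of reduced words by left multiplication. It shows that
trace-inequivalent reduced words represent distinct elements. -/
noncomputable def reducedAction (Γ : SimpleGraph (Fin N)) :
    ArtinGroup Γ →* Equiv.Perm (ReducedClass Γ) :=
  PresentedGroup.toGroup (f := generatorPerm Γ) <| by
    rintro r ⟨i, j, h, rfl⟩
    simp only [map_mul, map_inv, FreeGroup.lift_apply_of]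
    rw [mul_inv_eq_one, mul_inv_eq_iff_eq_mul]
    by_cases hij : i = j
    · rw [hij]
    · exact Equiv.ext fun x => letterAct_comm (l := (i, true)) (m := (j, true)) h hij x

theorem reducedAction_eval_singleton (l : Letter N) (x : ReducedClass Γ) :
    reducedAction Γ (eval Γ [l]) x = letterAct Γ l x := by
  have action_generator (i : Fin N) : reducedAction Γ (eval Γ [(i, true)]) = generatorPerm Γ i :=
    PresentedGroup.toGroup.of _
  obtain ⟨i, _ | _⟩ := l
  · have eval_false : eval Γ [(i, false)] = (eval Γ [(i, true)])⁻¹ :=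
      eval_singleton_inv (i, true)
    rw [eval_false, map_inv, action_generator]
    rfl
  · rw [action_generator]
    rfl

theorem reducedAction_eval {u : Word N} (h : IsReduced Γ u) :
    reducedAction Γ (eval Γ u) (.mk isReduced_nil) = .mk h := by
  induction u with
  | nil => rw [eval_nil, map_one, Equiv.Perm.one_apply]
  | cons l u ih =>
    obtain ⟨hu, hl⟩ := isReduced_cons.1 h
    rw [eval_cons, map_mul, Equiv.Perm.mul_apply, ih hu, reducedAction_eval_singleton]
    refine ReducedClass.mk_eq_mk (hu := hu.letterMul l).2 ?_
    rw [letterMul, if_neg hl]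

theorem traceEquiv_of_eval_eq {u v : Word N} (hu : IsReduced Γ u) (hv : IsReduced Γ v)
    (h : eval Γ u = eval Γ v) : TraceEquiv (Commutes Γ) u v :=
  ReducedClass.mk_eq_mk.1 <| by rw [← reducedAction_eval hu, h, reducedAction_eval hv]

theorem exists_isReduced_eval_eq (x : ArtinGroup Γ) : ∃ u, IsReduced Γ u ∧ eval Γ u = x := by
  obtain ⟨w, rfl⟩ := eval_surjective x
  induction w with
  | nil => exact ⟨[], isReduced_nil, rfl⟩
  | cons l w ih =>
    obtain ⟨u, hu, huw⟩ := ih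
    exact ⟨letterMul Γ l u, hu.letterMul l, by
      rw [eval_letterMul, eval_cons, huw, ← eval_cons]⟩

end Action

/-! ### Conjugate cyclically reduced words -/

section Conjugacy

variable {N : ℕ} {Γ : SimpleGraph (Fin N)}

/-- The words are related by cyclings and commutations; this is symmetric because a cycling is
undone by further cyclings. -/
abbrev CyclicEquiv (Γ : SimpleGraph (Fin N)) : Word N → Word N → Prop :=
  Relation.ReflTransGen (Step Γ)

theorem Step.perm {u v : Word N} (h : Step Γ u v) : u.Perm v := by
  cases h with
  | cycling l t => exact (List.perm_append_singleton l t).symm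
  | commutation u v l m _ => exact (List.Perm.swap m l v).append_left u

theorem Step.isConj {u v : Word N} (h : Step Γ u v) : IsConj (eval Γ u) (eval Γ v) := by
  cases h with
  | cycling l t =>
    rw [isConj_iff]
    exact ⟨(eval Γ [l])⁻¹, by rw [eval_cons l t, eval_append]; group⟩
  | commutation p q l m h =>
    rw [eval_append, eval_append, (TraceEquiv.swap q h).eval_eq]

theorem cyclicEquiv_append_comm (u v : Word N) : CyclicEquiv Γ (u ++ v) (v ++ u) := by
  induction u generalizing v with
  | nil => simpa using .refl
  | cons l u ih =>
    refine .head (.cycling l (u ++ v)) ?_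
    simpa using ih (v ++ [l])

theorem cyclicEquiv_of_isRotated {u v : Word N} (h : u ~r v) : CyclicEquiv Γ u v := by
  obtain ⟨r, hr, rfl⟩ := List.isRotated_iff_mod.1 h
  rw [List.rotate_eq_drop_append_take hr]
  simpa using cyclicEquiv_append_comm (Γ := Γ) (u.take r) (u.drop r)

theorem TraceEquiv.cyclicEquiv {u v : Word N} (h : TraceEquiv (Commutes Γ) u v) :
    CyclicEquiv Γ u v := by
  suffices ∀ p, CyclicEquiv Γ (p ++ u) (p ++ v) from this []
  induction h with
  | nil => exact fun _ => .refl
  | cons l _ ih => exact fun p => by simpa using ih (p ++ [l])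
  | swap u h => exact fun p => .single (.commutation p u _ _ h)
  | trans _ _ ih ih' => exact fun p => (ih p).trans (ih' p)

theorem Step.cyclicEquiv_symm {u v : Word N} (h : Step Γ u v) : CyclicEquiv Γ v u := by
  cases h with
  | cycling l t => exact cyclicEquiv_append_comm t [l]
  | commutation p q l m h => exact .single (.commutation p q m l fun h' => h h'.symm)

namespace CyclicEquiv

variable {u v : Word N}

theorem symm (h : CyclicEquiv Γ u v) : CyclicEquiv Γ v u := by
  induction h with
  | refl => exact .refl
  | tail _ h ih => exact h.cyclicEquiv_symm.trans ih

theorem perm (h : CyclicEquiv Γ u v) : u.Perm v := by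
  induction h with
  | refl => exact .refl _
  | tail _ h ih => exact ih.trans h.perm

theorem isConj (h : CyclicEquiv Γ u v) : IsConj (eval Γ u) (eval Γ v) := by
  induction h with
  | refl => exact .refl _
  | tail _ h ih => exact ih.trans h.isConj

end CyclicEquiv

theorem IsCyclicallyReduced.of_cyclicEquiv {u v : Word N} (hu : IsCyclicallyReduced Γ u)
    (h : CyclicEquiv Γ u v) : IsCyclicallyReduced Γ v :=
  ⟨hu.2 v h, fun w hw => hu.2 w (h.trans hw)⟩

theorem semiconjBy_of_mul_of_left {G : Type*} [Group G] {a b x y z : G}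
    (hab : SemiconjBy (a * b) x z) (ha : SemiconjBy a y z) : SemiconjBy b x y := by
  simpa using (SemiconjBy.inv_symm_left_iff.2 ha).mul_left hab

theorem semiconjBy_of_mul_of_right {G : Type*} [Group G] {a b x y z : G}
    (hab : SemiconjBy (a * b) x z) (hb : SemiconjBy b x y) : SemiconjBy a y z := by
  simpa using hab.mul_left (SemiconjBy.inv_symm_left_iff.2 hb)

theorem semiconjBy_eval_cycling (l : Letter N) (u : Word N) :
    SemiconjBy (eval Γ [l]) (eval Γ (u ++ [l])) (eval Γ (l :: u)) := by
  rw [SemiconjBy, eval_append, eval_cons l u, mul_assoc]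

theorem semiconjBy_eval_inv_cycling (l : Letter N) (u : Word N) :
    SemiconjBy (eval Γ [l.inv]) (eval Γ (l :: u)) (eval Γ (u ++ [l])) := by
  rw [eval_singleton_inv, SemiconjBy.inv_symm_left_iff]
  exact semiconjBy_eval_cycling l u

theorem exists_shorter_of_traceEquiv_append {g w w' : Word N} (hg : IsReduced Γ g) (hne : g ≠ [])
    (h : TraceEquiv (Commutes Γ) (w' ++ g) (g ++ w)) :
    ∃ g₁ w₁', IsReduced Γ g₁ ∧ g₁.length < g.length ∧ CyclicEquiv Γ w' w₁' ∧
      SemiconjBy (eval Γ g₁) (eval Γ w) (eval Γ w₁') := by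
  obtain ⟨l, g₁, rfl⟩ := List.exists_cons_of_ne_nil hne
  have hgw : SemiconjBy (eval Γ [l] * eval Γ g₁) (eval Γ w) (eval Γ w') := by
    rw [← eval_cons, SemiconjBy, ← eval_append, ← eval_append, h.eval_eq]
  have hl : IsInitial (Commutes Γ) l (w' ++ l :: g₁) :=
    (h.isInitial_iff l).2 (isInitial_cons.2 (.inl rfl))
  suffices ∃ w₁', CyclicEquiv Γ w' w₁' ∧ SemiconjBy (eval Γ [l]) (eval Γ w₁') (eval Γ w') by
    obtain ⟨w₁', hw₁', hlw⟩ := this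
    exact ⟨g₁, w₁', (isReduced_cons.1 hg).1, by simp, hw₁', semiconjBy_of_mul_of_left hgw hlw⟩
  rcases isInitial_append.1 hl with hlw | ⟨hcomm, -⟩
  · refine ⟨w'.erase l ++ [l], hlw.traceEquiv_cons_erase.cyclicEquiv.trans
      (cyclicEquiv_append_comm [l] (w'.erase l)), ?_⟩
    rw [hlw.traceEquiv_cons_erase.eval_eq]
    exact semiconjBy_eval_cycling l _
  · refine ⟨w', .refl, ?_⟩
    rw [SemiconjBy, ← eval_append, ← eval_append]
    simpa using (TraceEquiv.cons_append hcomm []).eval_eq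

theorem exists_shorter_conjugator {g w w' : Word N} (hg : IsReduced Γ g) (hne : g ≠ [])
    (hw : IsReduced Γ w) (hw' : IsReduced Γ w')
    (h : SemiconjBy (eval Γ g) (eval Γ w) (eval Γ w')) :
    ∃ g₁ w₁ w₁', IsReduced Γ g₁ ∧ g₁.length < g.length ∧ CyclicEquiv Γ w w₁ ∧
      CyclicEquiv Γ w' w₁' ∧ SemiconjBy (eval Γ g₁) (eval Γ w₁) (eval Γ w₁') := by
  by_cases hw'g : IsReduced Γ (w' ++ g)
  · by_cases hgw : IsReduced Γ (g ++ w)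
    · have htrace : TraceEquiv (Commutes Γ) (w' ++ g) (g ++ w) :=
        traceEquiv_of_eval_eq hw'g hgw (by rw [eval_append, eval_append, h.eq])
      obtain ⟨g₁, w₁', hg₁, hlt, hw₁', h₁⟩ := exists_shorter_of_traceEquiv_append hg hne htrace
      exact ⟨g₁, w, w₁', hg₁, hlt, .refl, hw₁', h₁⟩
    · obtain ⟨l, g₁, u, hgl, hwl⟩ := exists_cancel_of_not_isReduced_append hg hw hgw
      refine ⟨g₁, u ++ [l.inv], w', (hgl.isReduced_iff.1 hg).of_append_left,
        by simp [hgl.perm.length_eq],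
        hwl.cyclicEquiv.trans (cyclicEquiv_append_comm [l.inv] u), .refl, ?_⟩
      rw [hgl.eval_eq, hwl.eval_eq, eval_append] at h
      have hl := semiconjBy_eval_inv_cycling (Γ := Γ) l.inv u
      rw [Letter.inv_inv] at hl
      exact semiconjBy_of_mul_of_right h hl
  · obtain ⟨l, u, g₁, hwl, hgl⟩ := exists_cancel_of_not_isReduced_append hw' hg hw'g
    refine ⟨g₁, w, l :: u, (isReduced_cons.1 (hgl.isReduced_iff.1 hg)).1,
      by simp [hgl.perm.length_eq], .refl,
      hwl.cyclicEquiv.trans (cyclicEquiv_append_comm u [l]), ?_⟩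
    rw [hgl.eval_eq, hwl.eval_eq, eval_cons] at h
    exact semiconjBy_of_mul_of_left h (semiconjBy_eval_inv_cycling l u)

theorem cyclicEquiv_of_semiconjBy {g w w' : Word N} (hg : IsReduced Γ g)
    (hw : IsCyclicallyReduced Γ w) (hw' : IsCyclicallyReduced Γ w')
    (h : SemiconjBy (eval Γ g) (eval Γ w) (eval Γ w')) : CyclicEquiv Γ w w' := by
  induction hn : g.length using Nat.strong_induction_on generalizing g w w' with
  | _ n ih =>
    subst hn
    rcases eq_or_ne g [] with rfl | hne
    · rw [eval_nil, SemiconjBy, one_mul, mul_one] at h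
      exact (traceEquiv_of_eval_eq hw.1 hw'.1 h).cyclicEquiv
    · obtain ⟨g₁, w₁, w₁', hg₁, hlt, hw₁, hw₁', h₁⟩ :=
        exists_shorter_conjugator hg hne hw.1 hw'.1 h
      have h₁₁ : CyclicEquiv Γ w₁ w₁' :=
        ih _ hlt hg₁ (hw.of_cyclicEquiv hw₁) (hw'.of_cyclicEquiv hw₁') h₁ rfl
      exact (hw₁.trans h₁₁).trans hw₁'.symm

theorem IsCyclicallyReduced.cyclicEquiv_of_isConj {w w' : Word N} (hw : IsCyclicallyReduced Γ w)
    (hw' : IsCyclicallyReduced Γ w') (h : IsConj (eval Γ w) (eval Γ w')) :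
    CyclicEquiv Γ w w' := by
  obtain ⟨c, hc⟩ := h
  obtain ⟨g, hg, hgc⟩ := exists_isReduced_eval_eq (c : ArtinGroup Γ)
  exact cyclicEquiv_of_semiconjBy hg hw hw' (hgc ▸ hc)

end Conjugacy

/-! ### Heaps of bi-infinite words -/

section Heap

variable {P Q R α β : Type*} [LinearOrder P] [LinearOrder Q] [LinearOrder R]

/-- An isomorphism between the heaps of two words `f` and `g`, whose positions form linear orders
`P` and `Q`: a bijection of the positions that preserves letters and the order of any two positions
whose letters are related by the dependence relation `D`. -/
structure HeapIso (D : α → α → Prop) (f : P → α) (g : Q → α) extends P ≃ Q where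
  map_letter : ∀ i, g (toEquiv i) = f i
  map_lt : ∀ i j, D (f i) (f j) → i < j → toEquiv i < toEquiv j

namespace HeapIso

variable {D : α → α → Prop} {f : P → α} {g : Q → α} {h : R → α}

/-- The identity isomorphism. -/
def refl (f : P → α) : HeapIso D f f where
  toEquiv := .refl P
  map_letter _ := rfl
  map_lt _ _ _ hij := hij

/-- The inverse isomorphism. -/
def symm [Std.Symm D] (e : HeapIso D f g) : HeapIso D g f where
  toEquiv := e.toEquiv.symm
  map_letter i := by simpa using (e.map_letter (e.toEquiv.symm i)).symm
  map_lt i j hD hij := by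
    obtain ⟨i, rfl⟩ := e.toEquiv.surjective i
    obtain ⟨j, rfl⟩ := e.toEquiv.surjective j
    rw [e.map_letter, e.map_letter] at hD
    simp only [Equiv.symm_apply_apply]
    by_contra hji
    rcases (not_lt.1 hji).eq_or_lt with rfl | hji
    · exact hij.false
    · exact hij.asymm (e.map_lt j i (Std.Symm.symm _ _ hD) hji)

/-- The composition of isomorphisms. -/
def trans (e : HeapIso D f g) (e' : HeapIso D g h) : HeapIso D f h where
  toEquiv := e.toEquiv.trans e'.toEquiv
  map_letter i := (e'.map_letter _).trans (e.map_letter i)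
  map_lt i j hD hij :=
    e'.map_lt _ _ (by rwa [e.map_letter, e.map_letter]) (e.map_lt i j hD hij)

/-- The isomorphism induced by a map `φ` of alphabets that reflects dependence. -/
def map {D' : β → β → Prop} {φ : α → β} (hφ : ∀ a b, D' (φ a) (φ b) → D a b)
    (e : HeapIso D f g) : HeapIso D' (φ ∘ f) (φ ∘ g) where
  toEquiv := e.toEquiv
  map_letter i := congrArg φ (e.map_letter i)
  map_lt i j hD hij := e.map_lt i j (hφ _ _ hD) hij

end HeapIso

variable {V : Type*} [LinearOrder V] {D : V → V → Prop}

/-- A word is normal if no letter can be moved, by exchanges of independent letters, in front of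
an earlier smaller letter. -/
def IsNormalSequence (D : V → V → Prop) (x : P → V) : Prop :=
  ∀ ⦃i j⦄, i < j → x i < x j → ∃ m, i ≤ m ∧ m < j ∧ D (x m) (x j)

theorem IsNormalSequence.exists_inversion_lt [LocallyFiniteOrder P] [Std.Refl D] {x : P → V}
    (hx : IsNormalSequence D x) {τ : P → Q} (hτ : ∀ i j, D (x i) (x j) → i < j → τ i < τ j)
    {i j : P} (hij : i < j) (hinv : τ j < τ i) : ∃ m, i < m ∧ τ m < τ i ∧ x m < x i := by
  obtain ⟨m, hm, hmin⟩ := ((Finset.Ioc i j).filter (τ · < τ i)).exists_minimal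
    ⟨j, by simp [hij, hinv]⟩
  simp only [Finset.mem_filter, Finset.mem_Ioc] at hm hmin
  obtain ⟨⟨him, hmj⟩, hτm⟩ := hm
  refine ⟨m, him, hτm, lt_of_not_ge fun hle => ?_⟩
  rcases hle.eq_or_lt with heq | hlt
  · exact hτm.asymm (hτ i m (heq ▸ Std.Refl.refl _) him)
  · obtain ⟨k, hik, hkm, hD⟩ := hx him hlt
    have hτk : τ k < τ i := (hτ k m hD hkm).trans hτm
    have hik' : i < k := hik.lt_of_ne fun e => hτk.ne (congrArg τ e.symm)
    exact hkm.not_ge (hmin ⟨⟨hik', (hkm.trans_le hmj).le⟩, hτk⟩ hkm.le)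

/- An inversion `(i, j)` of `e` yields an inversion `(i, m)` with `x m < x i`; seen as an inversion
of the inverse of `e`, it yields an inversion `(k, m)` of `e` with `x k < x m`. So the letters of
the first members of inversions would descend forever. -/
theorem HeapIso.strictMono [LocallyFiniteOrder P] [LocallyFiniteOrder Q] [WellFoundedLT V]
    [Std.Refl D] [Std.Symm D] {x : P → V} {y : Q → V} (e : HeapIso D x y)
    (hx : IsNormalSequence D x) (hy : IsNormalSequence D y) : StrictMono e.toEquiv := by
  suffices no_inversion : ∀ v i j, x i = v → i < j → ¬ e.toEquiv j < e.toEquiv i from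
    fun i j hij => (not_lt.1 (no_inversion _ i j rfl hij)).lt_of_ne (e.toEquiv.injective.ne hij.ne)
  intro v
  induction v using WellFoundedLT.induction with
  | ind v ih =>
    rintro i j rfl hij hinv
    obtain ⟨m, him, hmi, hxm⟩ := hx.exists_inversion_lt e.map_lt hij hinv
    obtain ⟨k, hmk, hkm, hxk⟩ := hy.exists_inversion_lt e.symm.map_lt (i := e.toEquiv m)
      (j := e.toEquiv i) hmi (by simpa [HeapIso.symm] using him)
    obtain ⟨k, rfl⟩ := e.toEquiv.surjective k
    have hkm' : k < m := by simpa [HeapIso.symm] using hkm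
    have hxk' : x k < x m := by rwa [← e.map_letter k, ← e.map_letter m]
    exact ih _ (hxk'.trans hxm) k m rfl hkm' hmk

theorem exists_eq_add_of_strictMono {e : ℤ ≃ ℤ} (he : StrictMono e) : ∃ c, ∀ i, e i = i + c := by
  let e' : ℤ ≃o ℤ := he.orderIsoOfSurjective e e.surjective
  have e_add_one (i : ℤ) : e (i + 1) = e i + 1 := e'.map_succ i
  refine ⟨e 0, fun i => ?_⟩
  induction i using Int.induction_on with
  | zero => simp
  | succ n ih => rw [e_add_one, ih]; ring
  | pred n ih =>
    have h := e_add_one (-(n : ℤ) - 1)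
    rw [sub_add_cancel, ih] at h
    omega

theorem HeapIso.exists_add [WellFoundedLT V] [Std.Refl D] [Std.Symm D] {x y : ℤ → V}
    (e : HeapIso D x y) (hx : IsNormalSequence D x) (hy : IsNormalSequence D y) :
    ∃ c, ∀ i, e.toEquiv i = i + c :=
  exists_eq_add_of_strictMono (e.strictMono hx hy)

end Heap

/-! ### Exchanging neighbours in a bi-infinite word -/

section SwapSuccAt

open scoped Classical in
/-- The map exchanging `i` and `i + 1` for each `i ∈ S`, where `S` does not contain two consecutive
integers. -/
noncomputable def swapSuccAt (S : Set ℤ) (i : ℤ) : ℤ :=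
  if i ∈ S then i + 1 else if i - 1 ∈ S then i - 1 else i

variable {S : Set ℤ}

theorem swapSuccAt_involutive (hS : ∀ i ∈ S, i + 1 ∉ S) : Function.Involutive (swapSuccAt S) := by
  intro i
  by_cases hi : i ∈ S
  · simp [swapSuccAt, hi, hS i hi]
  · by_cases hi' : i - 1 ∈ S <;> simp [swapSuccAt, hi, hi']

theorem swapSuccAt_lt {i j : ℤ} (hij : i < j) (h : i ∈ S → j ≠ i + 1) (hS : ∀ i ∈ S, i + 1 ∉ S) :
    swapSuccAt S i < swapSuccAt S j := by
  unfold swapSuccAt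
  grind

/-- Exchanging independent neighbours does not change the heap. -/
noncomputable def HeapIso.ofSwapSuccAt {α : Type*} {D : α → α → Prop} {f g : ℤ → α}
    (hS : ∀ i ∈ S, i + 1 ∉ S) (hg : ∀ i, g (swapSuccAt S i) = f i)
    (hD : ∀ i ∈ S, ¬ D (f i) (f (i + 1))) : HeapIso D f g where
  toEquiv := (swapSuccAt_involutive hS).toPerm
  map_letter := hg
  map_lt i _ hij hlt := swapSuccAt_lt hlt (fun hi hj => hD i hi (hj ▸ hij)) hS

end SwapSuccAt

/-! ### Periodic words -/

section Periodic

variable {α : Type*} {d : α} {w v : List α}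

/-- The bi-infinite word `…www…` with `w` starting at position `0`; the default letter `d` only
occurs if `w` is empty. -/
def periodic (d : α) (w : List α) (i : ℤ) : α := w.getD (i % w.length).toNat d

@[simp] theorem periodic_nil (i : ℤ) : periodic d [] i = d := by simp [periodic]

theorem periodic_natCast {k : ℕ} (hk : k < w.length) : periodic d w k = w[k] := by
  have hmod : ((k : ℤ) % w.length).toNat = k := by
    rw [← Int.natCast_mod, Int.toNat_natCast, Nat.mod_eq_of_lt hk]
  rw [periodic, hmod, List.getD_eq_getElem _ _ hk]

theorem periodic_congr {i j : ℤ} (h : i ≡ j [ZMOD w.length]) :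
    periodic d w i = periodic d w j := by
  rw [periodic, periodic, h.eq]

theorem exists_natCast_modEq {n : ℕ} (hn : 0 < n) (i : ℤ) : ∃ k < n, i ≡ k [ZMOD n] := by
  have hk : ((i % n).toNat : ℤ) = i % n := Int.toNat_of_nonneg (Int.emod_nonneg _ (by omega))
  have hlt := Int.emod_lt_of_pos i (Int.natCast_pos.2 hn)
  exact ⟨(i % n).toNat, by omega, by rw [hk]; exact (Int.mod_modEq i n).symm⟩

theorem periodic_rotate (w : List α) (r : ℕ) (i : ℤ) :
    periodic d (w.rotate r) i = periodic d w (i + r) := by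
  rcases eq_or_ne w [] with rfl | hne
  · simp
  have hpos := List.length_pos_iff.2 hne
  obtain ⟨k, hk, hik⟩ := exists_natCast_modEq hpos i
  have hk' : k < (w.rotate r).length := by simpa using hk
  have hmod : (((k + r) % w.length : ℕ) : ℤ) ≡ i + r [ZMOD w.length] := by
    push_cast
    exact (Int.mod_modEq _ _).trans (hik.symm.add_right _)
  rw [← periodic_congr hmod, periodic_natCast (Nat.mod_lt _ hpos),
    periodic_congr (by simpa using hik), periodic_natCast hk', List.getElem_rotate]

theorem exists_isRotated_periodic_add (d : α) (w : List α) (c : ℤ) :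
    ∃ v, w ~r v ∧ ∀ i, periodic d v i = periodic d w (i + c) := by
  rcases eq_or_ne w [] with rfl | hne
  · exact ⟨[], .refl _, by simp⟩
  obtain ⟨r, -, hr⟩ := exists_natCast_modEq (List.length_pos_iff.2 hne) c
  exact ⟨w.rotate r, ⟨r, rfl⟩, fun i => by
    rw [periodic_rotate, periodic_congr (hr.add_left i)]⟩

theorem eq_of_periodic_eq (hlen : w.length = v.length) (h : periodic d w = periodic d v) :
    w = v :=
  List.ext_getElem hlen fun k hk hk' => by
    rw [← periodic_natCast (d := d) hk, ← periodic_natCast (d := d) hk', h]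

theorem isRotated_of_periodic_add (hlen : w.length = v.length) {c : ℤ}
    (h : ∀ i, periodic d v (i + c) = periodic d w i) : w ~r v := by
  obtain ⟨u, hvu, hu⟩ := exists_isRotated_periodic_add d v c
  have huw : u = w := eq_of_periodic_eq (hvu.perm.length_eq.symm.trans hlen.symm)
    (funext fun i => (hu i).trans (h i))
  exact huw ▸ hvu.symm

variable {D : α → α → Prop}

theorem nonempty_heapIso_of_isRotated (h : w ~r v) :
    Nonempty (HeapIso D (periodic d w) (periodic d v)) := by
  obtain ⟨r, rfl⟩ := h
  exact ⟨{
    toEquiv := Equiv.subRight (r : ℤ)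
    map_letter := fun i => by simp [periodic_rotate]
    map_lt := fun i j _ hij => by simpa using hij }⟩

theorem periodic_swapSuccAt (l m : α) (t : List α) (i : ℤ) :
    periodic d (m :: l :: t) (swapSuccAt {i | ((t.length + 2 : ℕ) : ℤ) ∣ i} i) =
      periodic d (l :: m :: t) i := by
  set n := t.length + 2
  have periodic_eq (a b : α) {k : ℕ} {j : ℤ} (hk : k < n) (hj : j ≡ k [ZMOD n]) :
      periodic d (a :: b :: t) j = (a :: b :: t)[k]'hk := by
    rw [← periodic_natCast hk]
    exact periodic_congr hj
  obtain ⟨k, hk, hik⟩ := exists_natCast_modEq (n := n) (by omega) i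
  have not_dvd {c : ℤ} (hc : 0 < c) (hcn : c < n) : ¬ (n : ℤ) ∣ c := fun h =>
    (Int.le_of_dvd hc h).not_gt hcn
  rw [periodic_eq l m hk hik, swapSuccAt, Set.mem_ofPred, Set.mem_ofPred,
    hik.dvd_iff, (hik.sub_right 1).dvd_iff]
  rcases k with _ | _ | k
  · rw [if_pos (by simp), periodic_eq m l (k := 1) (by omega) (hik.add_right 1)]
    rfl
  · rw [if_neg (not_dvd (by omega) (by omega)), if_pos (by simp),
      periodic_eq m l (k := 0) (by omega) (hik.sub_right 1)]
    rfl
  · rw [if_neg (not_dvd (by omega) (by omega)), if_neg (not_dvd (by omega) (by omega)),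
      periodic_eq m l hk hik]
    rfl

theorem nonempty_heapIso_swap {l m : α} (hlm : ¬ D l m) (t : List α) :
    Nonempty (HeapIso D (periodic d (l :: m :: t)) (periodic d (m :: l :: t))) := by
  refine ⟨.ofSwapSuccAt (S := {i | ((t.length + 2 : ℕ) : ℤ) ∣ i}) ?_ (periodic_swapSuccAt l m t) ?_⟩
  · intro i hi hi'
    have hone : ((t.length + 2 : ℕ) : ℤ) ∣ 1 := (Int.dvd_add_right hi).1 hi'
    have := Int.le_of_dvd one_pos hone
    omega
  · intro i hi
    have hmod : i ≡ 0 [ZMOD (l :: m :: t).length] := Int.modEq_zero_iff_dvd.2 hi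
    have hi₀ : periodic d (l :: m :: t) i = l :=
      (periodic_congr hmod).trans (periodic_natCast (k := 0) (by simp))
    have hi₁ : periodic d (l :: m :: t) (i + 1) = m :=
      (periodic_congr (hmod.add_right 1)).trans (periodic_natCast (k := 1) (by simp))
    rwa [hi₀, hi₁]

theorem nonempty_heapIso_commutation {l m : α} (hlm : ¬ D l m) (p q : List α) :
    Nonempty (HeapIso D (periodic d (p ++ l :: m :: q)) (periodic d (p ++ m :: l :: q))) := by
  obtain ⟨e₁⟩ := nonempty_heapIso_of_isRotated (D := D) (d := d)
    (List.isRotated_append (l := p) (l' := l :: m :: q))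
  obtain ⟨e₂⟩ := nonempty_heapIso_swap (d := d) hlm (q ++ p)
  obtain ⟨e₃⟩ := nonempty_heapIso_of_isRotated (D := D) (d := d)
    (List.isRotated_append (l := m :: l :: q) (l' := p))
  exact ⟨(e₁.trans e₂).trans e₃⟩

end Periodic

/-! ### Cyclic normal forms -/

section CyclicNormalForm

variable {N : ℕ} {Γ : SimpleGraph (Fin N)}

/-- The dependence relation on indices. Equal indices count as dependent although their letters
commute: exchanging adjacent letters of equal index in a reduced word does not change the word. -/
def Dep (Γ : SimpleGraph (Fin N)) (i j : Fin N) : Prop := i = j ∨ Γ.Adj i j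

instance : Std.Refl (Dep Γ) := ⟨fun _ => .inl rfl⟩

instance : Std.Symm (Dep Γ) := ⟨fun _ _ => .imp Eq.symm SimpleGraph.Adj.symm⟩

theorem Step.nonempty_heapIso (d : Letter N) {u v : Word N} (h : Step Γ u v)
    (hu : IsReduced Γ u) :
    Nonempty (HeapIso (Function.onFun (Dep Γ) Prod.fst) (periodic d u) (periodic d v)) := by
  cases h with
  | cycling l t => exact nonempty_heapIso_of_isRotated (List.isRotated_append (l := [l]))
  | commutation p q l m h =>
    by_cases hlm : l.1 = m.1
    · rcases Letter.eq_or_eq_inv_of_fst_eq hlm with rfl | rfl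
      · exact ⟨.refl _⟩
      · exact (hu ⟨p, [], q, m.1, !m.2, by simp [Letter.inv], by simp⟩).elim
    · exact nonempty_heapIso_commutation (by simp [Function.onFun, Dep, hlm, h]) p q

theorem IsCyclicallyReduced.nonempty_heapIso (d : Letter N) {u v : Word N}
    (hu : IsCyclicallyReduced Γ u) (h : CyclicEquiv Γ u v) :
    Nonempty (HeapIso (Function.onFun (Dep Γ) Prod.fst) (periodic d u) (periodic d v)) := by
  induction h with
  | refl => exact ⟨.refl _⟩
  | tail hv hstep ih =>
    obtain ⟨e⟩ := ih
    obtain ⟨e'⟩ := hstep.nonempty_heapIso d (hu.2 _ hv)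
    exact ⟨e.trans e'⟩

theorem IsInitiallyNormal.exists_adj {w : Word N} (h : IsInitiallyNormal Γ w) {k : ℕ}
    (hk : k < w.length) (hlt : w[0].1 < w[k].1) :
    ∃ m, ∃ hm : m < k, Γ.Adj w[m].1 w[k].1 := by
  by_contra! hcomm
  have hmove : TraceEquiv (Commutes Γ) (w[k] :: (w.take k ++ w.drop (k + 1))) w := by
    have htake : ∀ b ∈ w.take k, Commutes Γ w[k] b := by
      intro b hb hadj
      obtain ⟨m, hm, rfl⟩ := List.mem_take_iff_getElem.1 hb
      exact hcomm m (by omega) hadj.symm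
    simpa using TraceEquiv.cons_append htake (w.drop (k + 1))
  have hw : w = w[0] :: w.tail := by
    cases w with
    | nil => simp at hk
    | cons => rfl
  exact (h.2 _ _ hw _ _ (hmove.isReduced_iff.2 h.1) hmove.eval_eq).not_gt hlt

theorem IsCyclicNormalForm.isNormalSequence {w : Word N} (hw : IsCyclicNormalForm Γ w)
    (d : Letter N) : IsNormalSequence (Dep Γ) (Prod.fst ∘ periodic d w) := by
  intro i j hij hlt
  obtain ⟨v, hwv, hv⟩ := exists_isRotated_periodic_add d w i
  have hpos : 0 < v.length := by
    rw [List.length_pos_iff]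
    rintro rfl
    simp [List.isRotated_nil_iff.1 hwv] at hlt
  obtain ⟨k, hk, hjk⟩ := exists_natCast_modEq hpos (j - i)
  have hki : (k : ℤ) ≤ j - i := by
    by_contra! hlt'
    have := Int.le_of_dvd (sub_pos.2 hlt') hjk.dvd
    omega
  have hj : periodic d w j = v[k] := by
    rw [← periodic_natCast hk, ← periodic_congr hjk, hv, sub_add_cancel]
  have getElem_eq {m : ℕ} (hm : m < v.length) : v[m] = periodic d w (m + i) := by
    rw [← periodic_natCast hm, hv]
  have hi : periodic d w i = v[0] := by simp [getElem_eq]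
  simp only [Function.comp_apply, hi, hj] at hlt ⊢
  obtain ⟨m, hmk, hadj⟩ := ((hw.2.2 v hwv).2 v List.suffix_rfl).exists_adj hk hlt
  exact ⟨m + i, by omega, by omega, .inr (by rwa [← getElem_eq])⟩

theorem IsCyclicNormalForm.isRotated_of_cyclicEquiv {w w' : Word N}
    (hw : IsCyclicNormalForm Γ w) (hw' : IsCyclicNormalForm Γ w') (h : CyclicEquiv Γ w w') :
    w ~r w' := by
  rcases w with _ | ⟨d, t⟩
  · rw [h.perm.nil_eq]
  · obtain ⟨e⟩ := hw.1.nonempty_heapIso d h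
    obtain ⟨c, hc⟩ := (e.map (φ := Prod.fst) (D' := Dep Γ) fun _ _ => id).exists_add
      (hw.isNormalSequence d) (hw'.isNormalSequence d)
    exact isRotated_of_periodic_add h.perm.length_eq fun i => by
      rw [← hc]; exact e.map_letter i

end CyclicNormalForm

end RAAG

theorem propositionT {N : ℕ} (Γ : SimpleGraph (Fin N)) (w w' : RAAG.Word N)
    (hw : RAAG.IsCyclicNormalForm Γ w) (hw' : RAAG.IsCyclicNormalForm Γ w') :
    IsConj (RAAG.eval Γ w) (RAAG.eval Γ w') ↔ w ~r w' :=
  ⟨fun h => hw.isRotated_of_cyclicEquiv hw' (hw.1.cyclicEquiv_of_isConj hw'.1 h),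
    fun h => (RAAG.cyclicEquiv_of_isRotated h).isConj⟩
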